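/- Let $B=\{\frac{2}{4^n} : n\in\mathbb{N},\ n\ge 1\}\cup\{\frac{3}{4^n} : n\in\mathbb{N},\ n\ge 1\}\subset\mathbb{R}$, and let $A\subseteq B$ be such that both $A$ and $B\setminus A$ are infinite. Let $(a_n)_{n\in\mathbb{N}}$ be a sequence that lists every element of $A$ exactly once. Then the set of subsums $\{\sum_{n\in S}a_n : S\subseteq\mathbb{N}\}$, with the topology inherited from $\mathbb{R}$, is homeomorphic to the Cantor ternary set. -/

import Mathlib

/-- The set of subsums of a sequence of reals: all the sums `∑_{n ∈ S} a n` with `S ⊆ ℕ`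
(finite or infinite; the empty subset gives the subsum `0`). -/
def subsums (a : ℕ → ℝ) : Set ℝ :=
  {x | ∃ S : Set ℕ, HasSum (fun n : S => a n) x}

/-- The set `{2 / 4 ^ n : n > 0} ∪ {3 / 4 ^ n : n > 0}` of reals. -/
def cantorvalTerms : Set ℝ :=
  {x | ∃ n : ℕ, 0 < n ∧ x = 2 / 4 ^ n} ∪ {x | ∃ n : ℕ, 0 < n ∧ x = 3 / 4 ^ n}

open Set Filter Topology MeasureTheory
open scoped Pointwise

/-! The set of subsums is compact, being a continuous image of Cantor space, and perfect, since
toggling a far term moves a sum slightly. Only interior points could keep it from being a Cantor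
set. A subsum is a base-four expansion with at most four digits (0, 2, 3, 5) available at each
place. The infinitely many missing terms meet infinitely many places and leave at most two digits
there. Each such place halves the measure bound, so the set is null and has empty interior. -/

/-- A nonempty bounded perfect subset of the line with dense complement. -/
structure IsRealCantorSet (C : Set ℝ) : Prop where
  perfect : Perfect C
  nonempty : C.Nonempty
  bounded : Bornology.IsBounded C
  dense_compl : Dense Cᶜ

/-! ### Topological characterisation of Cantor sets on the line -/

namespace IsRealCantorSet

theorem inter_of_isClopen {C U V : Set ℝ} (hC : IsRealCantorSet C) (hU : IsOpen U)
    (hV : IsClosed V) (hUV : U ∩ C = V ∩ C) (hne : (U ∩ C).Nonempty) :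
    IsRealCantorSet (U ∩ C) where
  perfect := ⟨hUV ▸ hV.inter hC.perfect.closed, hC.perfect.acc.open_inter hU⟩
  nonempty := hne
  bounded := hC.bounded.subset inter_subset_right
  dense_compl := hC.dense_compl.mono (compl_subset_compl.2 inter_subset_right)

/-- Cut at a point outside `C` in the middle third of its convex hull. -/
theorem exists_split {C : Set ℝ} (hC : IsRealCantorSet C) :
    ∃ D : Bool → Set ℝ, (∀ i, IsRealCantorSet (D i)) ∧
      (∀ i, Metric.diam (D i) ≤ 2 / 3 * Metric.diam C) ∧ Disjoint (D false) (D true) ∧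
      ⋃ i, D i = C := by
  have hcomp : IsCompact C := Metric.isCompact_of_isClosed_isBounded hC.perfect.closed hC.bounded
  have ha := hcomp.sInf_mem hC.nonempty
  have hb := hcomp.sSup_mem hC.nonempty
  have hmem : ∀ x ∈ C, sInf C ≤ x ∧ x ≤ sSup C := fun x hx =>
    ⟨csInf_le hcomp.bddBelow hx, le_csSup hcomp.bddAbove hx⟩
  rw [Real.diam_eq hC.bounded]
  set a := sInf C
  set b := sSup C
  have hab : a < b := by
    obtain ⟨y, ⟨-, hy⟩, hya⟩ :=
      preperfect_iff_nhds.1 hC.perfect.acc a ha univ univ_mem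
    exact lt_of_lt_of_le (lt_of_le_of_ne (hmem y hy).1 hya.symm) (hmem y hy).2
  obtain ⟨c, hcC, hc⟩ := hC.dense_compl.exists_mem_open (isOpen_Ioo (a := a + (b - a) / 3)
    (b := b - (b - a) / 3)) ⟨(a + b) / 2, by constructor <;> linarith⟩
  have hne : ∀ x ∈ C, x ≠ c := fun x hx h => hcC (h ▸ hx)
  refine ⟨fun i => cond i (Ioi c ∩ C) (Iio c ∩ C), ?_, ?_, ?_, ?_⟩
  · rintro (_ | _)
    · refine hC.inter_of_isClopen isOpen_Iio (isClosed_Iic (a := c)) ?_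
        ⟨a, by simp only [mem_Iio]; linarith [hc.1], ha⟩
      ext x
      simp only [mem_inter_iff, mem_Iio, mem_Iic]
      exact ⟨fun h => ⟨h.1.le, h.2⟩, fun h => ⟨lt_of_le_of_ne h.1 (hne x h.2), h.2⟩⟩
    · refine hC.inter_of_isClopen isOpen_Ioi (isClosed_Ici (a := c)) ?_
        ⟨b, by simp only [mem_Ioi]; linarith [hc.2], hb⟩
      ext x
      simp only [mem_inter_iff, mem_Ioi, mem_Ici]
      exact ⟨fun h => ⟨h.1.le, h.2⟩, fun h => ⟨lt_of_le_of_ne h.1 (hne x h.2).symm, h.2⟩⟩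
  · rintro (_ | _)
    · refine (Metric.diam_mono (t := Icc a c) (fun x hx => ⟨(hmem x hx.2).1, hx.1.le⟩)
        (Metric.isBounded_Icc _ _)).trans ?_
      rw [Real.diam_Icc (by linarith [hc.1])]
      linarith [hc.2]
    · refine (Metric.diam_mono (t := Icc c b) (fun x hx => ⟨hx.1.le, (hmem x hx.2).2⟩)
        (Metric.isBounded_Icc _ _)).trans ?_
      rw [Real.diam_Icc (by linarith [hc.2])]
      linarith [hc.1]
  · exact disjoint_left.2 fun x hx hx' => lt_asymm (show x < c from hx.1) hx'.1
  · ext x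
    simp only [mem_iUnion, Bool.exists_bool, cond_false, cond_true, mem_inter_iff, mem_Iio, mem_Ioi]
    constructor
    · rintro (h | h) <;> exact h.2
    · intro hx
      rcases lt_or_gt_of_ne (hne x hx) with h | h
      · exact Or.inl ⟨h, hx⟩
      · exact Or.inr ⟨h, hx⟩

open CantorScheme PiNat

/-- A nonempty bounded perfect subset of the line with dense complement is homeomorphic to
the Cantor space. -/
theorem nonempty_homeomorph {C : Set ℝ} (hC : IsRealCantorSet C) :
    Nonempty (C ≃ₜ (ℕ → Bool)) := by
  choose D hD hdiamD hdisjD hunion using fun E : {E : Set ℝ // IsRealCantorSet E} => E.2.exists_split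
  let P : List Bool → {E : Set ℝ // IsRealCantorSet E} := fun l =>
    l.rec ⟨C, hC⟩ fun i _ E => ⟨D E i, hD E i⟩
  let A : List Bool → Set ℝ := fun l => (P l).1
  have hanti : ClosureAntitone A :=
    Antitone.closureAntitone (fun l i => (subset_iUnion (D (P l)) i).trans (hunion (P l)).le)
      fun l => (P l).2.perfect.closed
  have hdiam_le : ∀ l, Metric.diam (A l) ≤ (2 / 3) ^ l.length * Metric.diam C := by
    intro l
    induction l with
    | nil => simp [A, P]
    | cons i l ih =>
      refine (hdiamD (P l) i).trans ?_
      rw [List.length_cons, pow_succ']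
      have : Metric.diam (P l).1 ≤ (2 / 3) ^ l.length * Metric.diam C := ih
      linarith
  have hpow : Tendsto (fun n : ℕ => (2 / 3 : ℝ) ^ n * Metric.diam C) atTop (𝓝 0) := by
    simpa using (tendsto_pow_atTop_nhds_zero_of_lt_one (r := (2 / 3 : ℝ)) (by norm_num)
      (by norm_num)).mul_const (Metric.diam C)
  have hdiam : VanishingDiam A := by
    intro x
    have h := ENNReal.tendsto_ofReal hpow
    rw [ENNReal.ofReal_zero] at h
    refine tendsto_of_tendsto_of_tendsto_of_le_of_le tendsto_const_nhds h (fun _ => zero_le) ?_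
    intro n
    have hle := hdiam_le (res x n)
    rw [res_length] at hle
    dsimp only
    rw [← ENNReal.ofReal_toReal (P (res x n)).2.bounded.ediam_ne_top]
    exact ENNReal.ofReal_le_ofReal hle
  have hdisj : CantorScheme.Disjoint A := by
    rintro l (_ | _) (_ | _) hij
    · exact absurd rfl hij
    · exact hdisjD (P l)
    · exact (hdisjD (P l)).symm
    · exact absurd rfl hij
  have hdom : ∀ x : ℕ → Bool, x ∈ (inducedMap A).1 := fun x => by
    rw [hanti.map_of_vanishingDiam hdiam fun l => (P l).2.nonempty]
    exact mem_univ x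
  let f : (ℕ → Bool) → ℝ := fun x => (inducedMap A).2 ⟨x, hdom x⟩
  have hf_mem : ∀ x n, f x ∈ A (res x n) := fun x n => map_mem ⟨x, hdom x⟩ n
  have hf_cont : Continuous f := hdiam.map_continuous.comp (by fun_prop)
  have hf_inj : Function.Injective f := fun x y hxy => by
    simpa only [← Subtype.val_inj] using hdisj.map_injective hxy
  have hcover : ∀ y ∈ C, ∀ n, ∃ x, y ∈ A (res x n) := by
    intro y hy n
    induction n with
    | zero => exact ⟨fun _ => false, hy⟩
    | succ n ih =>
      obtain ⟨x, hx⟩ := ih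
      have hx' : y ∈ (P (res x n)).1 := hx
      rw [← hunion (P (res x n)), mem_iUnion] at hx'
      obtain ⟨i, hi⟩ := hx'
      refine ⟨Function.update x n i, ?_⟩
      rw [res_succ, Function.update_self,
        res_eq_res.2 fun m hm => Function.update_of_ne hm.ne i x]
      exact hi
  have hsurj : ∀ y ∈ C, ∃ x, f x = y := by
    intro y hy
    change y ∈ range f
    -- The range is closed, so approximating `y` suffices; the branches from `hcover` need not be
    -- coherent in `n`.
    rw [← (isCompact_range hf_cont).isClosed.closure_eq, Metric.mem_closure_range_iff]
    intro ε hε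
    obtain ⟨n, hn⟩ := (hpow.eventually (gt_mem_nhds hε)).exists
    obtain ⟨x, hx⟩ := hcover y hy n
    refine ⟨x, (Metric.dist_le_diam_of_mem (P (res x n)).2.bounded hx (hf_mem x n)).trans_lt ?_⟩
    have hle := hdiam_le (res x n)
    rw [res_length] at hle
    exact hle.trans_lt hn
  let g : (ℕ → Bool) → C := fun x => ⟨f x, hf_mem x 0⟩
  have hg : Function.Bijective g :=
    ⟨fun x y h => hf_inj (congrArg Subtype.val h), fun y =>
      (hsurj y y.2).imp fun x hx => Subtype.ext hx⟩
  exact ⟨(Continuous.homeoOfEquivCompactToT2 (f := Equiv.ofBijective g hg)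
    (hf_cont.subtype_mk _)).symm⟩

end IsRealCantorSet

/-! ### Measure of sets of restricted base-four expansions -/

/-- The reals with a base-four expansion whose `n`-th digit lies in `D n`. -/
def quaternarySums (D : ℕ → Finset ℝ) : Set ℝ :=
  {x | ∃ d : ℕ → ℝ, (∀ n, d n ∈ D n) ∧ HasSum (fun n => d n / 4 ^ (n + 1)) x}

theorem quaternarySums_subset_iUnion (D : ℕ → Finset ℝ) :
    quaternarySums D ⊆
      ⋃ e ∈ D 0, (fun x => e / 4 + x) '' ((1 / 4 : ℝ) • quaternarySums fun n => D (n + 1)) := by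
  rintro x ⟨d, hd, hx⟩
  simp only [mem_iUnion]
  refine ⟨d 0, hd 0, x - d 0 / 4, ?_, by ring⟩
  refine mem_smul_set.2 ⟨4 * (x - d 0 / 4), ⟨fun n => d (n + 1), fun n => hd (n + 1), ?_⟩, ?_⟩
  · have h := ((hasSum_nat_add_iff' 1).2 hx).mul_left 4
    simp only [Finset.range_one, Finset.sum_singleton, zero_add, pow_one] at h
    refine h.congr_fun ?_
    intro n
    rw [pow_succ 4 (n + 1)]
    field_simp
  · rw [smul_eq_mul]
    ring

/-- Each leading digit contributes a translated quarter-scale copy of the tail set. -/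
theorem volume_quaternarySums_le (D : ℕ → Finset ℝ) :
    volume (quaternarySums D) ≤
      ENNReal.ofReal ((D 0).card / 4) * volume (quaternarySums fun n => D (n + 1)) := by
  refine (measure_mono (quaternarySums_subset_iUnion D)).trans
    ((measure_biUnion_finset_le _ _).trans ?_)
  simp only [image_add_left, measure_preimage_add, Measure.addHaar_smul, Finset.sum_const,
    Module.finrank_self, pow_one, nsmul_eq_mul]
  rw [← mul_assoc, ← ENNReal.ofReal_natCast, ← ENNReal.ofReal_mul (by positivity),
    abs_of_pos (by norm_num)]
  gcongr
  exact le_of_eq (by ring)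

theorem hasSum_const_div_four_pow (c : ℝ) : HasSum (fun n : ℕ => c / 4 ^ (n + 1)) (c / 3) := by
  have h := (hasSum_geometric_of_lt_one (r := (1 / 4 : ℝ)) (by norm_num) (by norm_num)).mul_left
    (c / 4)
  have hc : c / 4 * (1 - 1 / 4)⁻¹ = c / 3 := by ring
  rw [hc] at h
  refine h.congr_fun fun n => ?_
  rw [div_pow, one_pow, pow_succ]
  field_simp

theorem volume_quaternarySums_eq_zero {D : ℕ → Finset ℝ} {c : ℝ}
    (hD : ∀ n, ∀ e ∈ D n, e ∈ Icc 0 c) (hcard : ∀ n, (D n).card ≤ 4)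
    (hinf : {n | (D n).card ≤ 2}.Infinite) : volume (quaternarySums D) = 0 := by
  let M : ℕ → ENNReal := fun n => volume (quaternarySums fun k => D (k + n))
  have hstep : ∀ n, M n ≤ ENNReal.ofReal ((D n).card / 4) * M (n + 1) := by
    intro n
    have h := volume_quaternarySums_le fun k => D (k + n)
    simp only [zero_add] at h
    have hshift : (fun k => D (k + 1 + n)) = fun k => D (k + (n + 1)) :=
      funext fun k => congrArg D (by ring)
    rwa [hshift] at h
  -- With at most four digits, dropping the leading place cannot decrease the measure, so one may
  -- skip ahead to a place with two digits.
  have hmono : Monotone M := by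
    refine monotone_nat_of_le_succ fun n => (hstep n).trans ?_
    refine mul_le_of_le_one_left' (ENNReal.ofReal_le_one.2 ?_)
    have : ((D n).card : ℝ) ≤ 4 := by exact_mod_cast hcard n
    linarith
  have hbound : ∀ n, M n ≤ ENNReal.ofReal (c / 3) := by
    intro n
    refine (measure_mono (t := Icc 0 (c / 3)) ?_).trans (by simp)
    rintro x ⟨d, hd, hx⟩
    refine ⟨hx.nonneg fun k => div_nonneg (hD _ _ (hd k)).1 (by positivity),
      hasSum_le (fun k => ?_) hx (hasSum_const_div_four_pow c)⟩
    have := (hD _ _ (hd k)).2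
    gcongr
  have hhalf : ∀ k n, M n ≤ ENNReal.ofReal ((1 / 2) ^ k * (c / 3)) := by
    intro k
    induction k with
    | zero => simpa using hbound
    | succ k ih =>
      intro n
      obtain ⟨m, hm, hnm⟩ := hinf.exists_gt n
      refine (hmono hnm.le).trans ((hstep m).trans ?_)
      rw [pow_succ', mul_assoc, ENNReal.ofReal_mul (by norm_num)]
      refine mul_le_mul' (ENNReal.ofReal_le_ofReal ?_) (ih _)
      have : ((D m).card : ℝ) ≤ 2 := by exact_mod_cast hm
      linarith
  have hlim : Tendsto (fun k : ℕ => ENNReal.ofReal ((1 / 2) ^ k * (c / 3))) atTop (𝓝 0) := by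
    have h := ENNReal.tendsto_ofReal ((tendsto_pow_atTop_nhds_zero_of_lt_one (r := (1 / 2 : ℝ))
      (by norm_num) (by norm_num)).mul_const (c / 3))
    simpa using h
  exact le_antisymm (ge_of_tendsto' hlim fun k => hhalf k 0) zero_le

/-! ### Sets of subsums of summable sequences -/

theorem subsums_eq_range {a : ℕ → ℝ} (ha : Summable a) :
    subsums a = range fun s : ℕ → Bool => ∑' n, if s n then a n else 0 := by
  classical
  ext x
  constructor
  · rintro ⟨S, hS⟩
    refine ⟨fun n => decide (n ∈ S), ?_⟩
    have h := (hasSum_subtype_iff_indicator (f := a)).1 hS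
    simpa [indicator_apply] using h.tsum_eq
  · rintro ⟨s, rfl⟩
    refine ⟨{n | s n = true}, (hasSum_subtype_iff_indicator (f := a)).2 ?_⟩
    simpa [indicator_apply] using (ha.indicator {n | s n = true}).hasSum

theorem isCompact_subsums {a : ℕ → ℝ} (ha : Summable a) : IsCompact (subsums a) := by
  rw [subsums_eq_range ha]
  refine isCompact_range (continuous_tsum (u := fun n => |a n|) (fun n => ?_) ha.abs ?_)
  · exact (continuous_of_discreteTopology (f := fun b : Bool => if b then a n else 0)).comp
      (continuous_apply n)
  · intro n s
    split_ifs <;> simp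

theorem preperfect_subsums {a : ℕ → ℝ} (ha : Summable a) (ha0 : ∀ n, a n ≠ 0) :
    Preperfect (subsums a) := by
  classical
  rw [preperfect_iff_nhds]
  rintro x ⟨S, hS⟩ U hU
  have hS' := (hasSum_subtype_iff_indicator (f := a)).1 hS
  -- The change in the sum when membership of `n` is toggled.
  let v : ℕ → ℝ := fun n => if n ∈ S then -a n else a n
  have hv : Tendsto v atTop (𝓝 0) := by
    refine squeeze_zero_norm (fun n => ?_) (tendsto_norm_zero.comp ha.tendsto_atTop_zero)
    simp only [v, Function.comp]
    split_ifs <;> simp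
  have hxv : Tendsto (fun n => x + v n) atTop (𝓝 x) := by simpa using hv.const_add x
  obtain ⟨n, hn⟩ := (hxv.eventually hU).exists
  refine ⟨x + v n, ⟨hn, symmDiff S {n}, (hasSum_subtype_iff_indicator (f := a)).2 ?_⟩, ?_⟩
  · refine (hS'.add (hasSum_pi_single n (v n))).congr_fun fun m => ?_
    rcases eq_or_ne m n with rfl | hmn
    · by_cases hm : m ∈ S <;> simp [v, hm, mem_symmDiff]
    · by_cases hm : m ∈ S <;> simp [hm, hmn, mem_symmDiff]
  · have : v n ≠ 0 := by
      simp only [v]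
      split_ifs <;> simp [ha0 n]
    simpa using this

/-! ### Digits of the Guthrie–Nymann series -/

/-- The numerators of the terms of the Guthrie–Nymann series. -/
def cantorvalWeight (b : Bool) : ℝ := cond b 3 2

/-- The terms of the Guthrie–Nymann series, indexed by position and kind. -/
noncomputable def cantorvalTerm (p : ℕ × Bool) : ℝ := cantorvalWeight p.2 / 4 ^ (p.1 + 1)

theorem range_cantorvalTerm : range cantorvalTerm = cantorvalTerms := by
  ext x
  constructor
  · rintro ⟨⟨n, _ | _⟩, rfl⟩
    · exact Or.inl ⟨n + 1, n.succ_pos, rfl⟩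
    · exact Or.inr ⟨n + 1, n.succ_pos, rfl⟩
  · rintro (⟨n, hn, rfl⟩ | ⟨n, hn, rfl⟩) <;> obtain ⟨m, rfl⟩ := Nat.exists_eq_succ_of_ne_zero hn.ne'
    · exact ⟨(m, false), rfl⟩
    · exact ⟨(m, true), rfl⟩

theorem cantorvalTerm_pos (p : ℕ × Bool) : 0 < cantorvalTerm p := by
  rcases p with ⟨n, _ | _⟩ <;> simp only [cantorvalTerm, cantorvalWeight, cond] <;> positivity

theorem summable_cantorvalTerm : Summable cantorvalTerm := by
  rw [summable_prod_of_nonneg fun p => (cantorvalTerm_pos p).le]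
  refine ⟨fun n => (hasSum_fintype _).summable, ?_⟩
  simp only [tsum_fintype, cantorvalTerm, ← Finset.sum_div]
  exact (hasSum_const_div_four_pow _).summable

open Classical in
/-- The digits which the terms outside `T` can produce at position `n`. -/
noncomputable def availableDigits (T : Set (ℕ × Bool)) (n : ℕ) : Finset ℝ :=
  (Finset.univ.filter fun b => (n, b) ∉ T).powerset.image fun u => ∑ b ∈ u, cantorvalWeight b

theorem card_availableDigits_le (T : Set (ℕ × Bool)) (n : ℕ) :
    (availableDigits T n).card ≤ 4 := by
  classical
  refine Finset.card_image_le.trans ?_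
  rw [Finset.card_powerset]
  exact Nat.pow_le_pow_right (n := 2) (j := 2) two_pos (Finset.card_filter_le _ _)

theorem card_availableDigits_le_two {T : Set (ℕ × Bool)} {p : ℕ × Bool} (hp : p ∈ T) :
    (availableDigits T p.1).card ≤ 2 := by
  classical
  refine Finset.card_image_le.trans ?_
  rw [Finset.card_powerset]
  refine Nat.pow_le_pow_right (n := 2) (j := 1) two_pos (Nat.lt_succ_iff.1 ?_)
  refine (Finset.card_lt_card (t := Finset.univ) ?_).trans_le (by simp)
  exact Finset.filter_ssubset.2 ⟨p.2, Finset.mem_univ _, by simpa using hp⟩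

theorem availableDigits_subset_Icc (T : Set (ℕ × Bool)) (n : ℕ) :
    ∀ e ∈ availableDigits T n, e ∈ Icc (0 : ℝ) 5 := by
  classical
  have hpos : ∀ b, 0 ≤ cantorvalWeight b := by
    rintro (_ | _) <;> simp [cantorvalWeight]
  intro e he
  obtain ⟨u, -, rfl⟩ := Finset.mem_image.1 he
  refine ⟨Finset.sum_nonneg fun b _ => hpos b, ?_⟩
  refine (Finset.sum_le_univ_sum_of_nonneg hpos).trans ?_
  norm_num [cantorvalWeight]

/-- Summing the chosen terms position by position produces the digits. -/
theorem subsums_subset_quaternarySums {φ : ℕ → ℕ × Bool} (hφ : Function.Injective φ) :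
    subsums (cantorvalTerm ∘ φ) ⊆ quaternarySums (availableDigits (range φ)ᶜ) := by
  classical
  rintro x ⟨S, hS⟩
  have hS' : HasSum ((φ '' S).indicator cantorvalTerm) x := by
    refine (hφ.hasSum_iff fun p hp => indicator_of_notMem
      (fun h => hp (image_subset_range φ S h)) _).1 ?_
    refine ((hasSum_subtype_iff_indicator (f := cantorvalTerm ∘ φ)).1 hS).congr_fun fun n => ?_
    simp only [Function.comp_apply, indicator_apply, hφ.mem_set_image]
  refine ⟨fun n => ∑ b with (n, b) ∈ φ '' S, cantorvalWeight b, fun n => ?_, ?_⟩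
  · refine Finset.mem_image.2 ⟨_, Finset.mem_powerset.2 fun b hb => ?_, rfl⟩
    simp only [Finset.mem_filter, Finset.mem_univ, true_and] at hb ⊢
    exact not_not.2 (image_subset_range φ S hb)
  · refine (hS'.prod_fiberwise fun n => hasSum_fintype _).congr_fun fun n => ?_
    simp only [Finset.sum_div, Finset.sum_filter, indicator_apply, cantorvalTerm, ite_div, zero_div]

theorem theorem14 (A : Set ℝ) (hAB : A ⊆ cantorvalTerms) (hA : A.Infinite)
    (hBA : (cantorvalTerms \ A).Infinite) (a : ℕ → ℝ) (ha_inj : Function.Injective a)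
    (ha_range : Set.range a = A) :
    Nonempty (subsums a ≃ₜ cantorSet) := by
  have hmem : ∀ n, ∃ p, cantorvalTerm p = a n := fun n => by
    rw [← mem_range, range_cantorvalTerm]
    exact hAB (ha_range ▸ mem_range_self n)
  choose φ hφ using hmem
  have haφ : a = cantorvalTerm ∘ φ := funext fun n => (hφ n).symm
  have hφ_inj : Function.Injective φ := Function.Injective.of_comp (haφ ▸ ha_inj)
  have hsum : Summable a := haφ ▸ summable_cantorvalTerm.comp_injective hφ_inj
  have hmissing : (range φ)ᶜ.Infinite := by
    refine Infinite.of_image cantorvalTerm (hBA.mono ?_)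
    rintro x ⟨hx, hxA⟩
    rw [← range_cantorvalTerm] at hx
    obtain ⟨p, rfl⟩ := hx
    refine ⟨p, ?_, rfl⟩
    rintro ⟨n, rfl⟩
    exact hxA (ha_range ▸ ⟨n, (hφ n).symm⟩)
  -- A position carries only two terms, so infinitely many missing terms occupy infinitely many
  -- positions.
  have hpos : (Prod.fst '' (range φ)ᶜ).Infinite := fun hfin =>
    hmissing ((hfin.prod finite_univ).subset fun p hp => ⟨mem_image_of_mem _ hp, mem_univ p.2⟩)
  have hvol : volume (subsums a) = 0 := by
    rw [haφ]
    refine measure_mono_null (subsums_subset_quaternarySums hφ_inj)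
      (volume_quaternarySums_eq_zero (availableDigits_subset_Icc _) (card_availableDigits_le _)
        (hpos.mono ?_))
    rintro _ ⟨p, hp, rfl⟩
    exact card_availableDigits_le_two hp
  have hcomp := isCompact_subsums hsum
  have hcantor : IsRealCantorSet (subsums a) :=
    { perfect := ⟨hcomp.isClosed,
        preperfect_subsums hsum fun n => by rw [← hφ n]; exact (cantorvalTerm_pos _).ne'⟩
      nonempty := by rw [subsums_eq_range hsum]; exact range_nonempty _
      bounded := hcomp.isBounded
      dense_compl := interior_eq_empty_iff_dense_compl.1 (Measure.interior_eq_empty_of_null hvol) }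
  exact hcantor.nonempty_homeomorph.map fun e => e.trans cantorSetHomeomorphNatToBool.symm
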